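/- **Theorem (asymptotic sharpness with a learned log-likelihood ratio).** Let $P_0,P_1$ be probability measures on a measurable space $\mathcal X$ with densities $f_0,f_1$ with respect to a common measure $\nu$, and let $\ell(x)=\log\bigl(f_0(x)/f_1(x)\bigr)$. Assume that $\ell$ is finite $P_0$- and $P_1$-almost surely and that $\mathrm{Var}_{X\sim P_0}(\ell(X)),\ \mathrm{Var}_{X\sim P_1}(\ell(X))\in(0,\infty)$. Write $[m]=\{1,\dots,m\}$. For each $n\ge 2$ let $X_{1,n},\dots,X_{n,n}$ be independent $\mathcal X$-valued random variables such that, for some $\xi_n\in[n-1]$, $X_{i,n}\sim P_0$ for $i\le \xi_n$ and $X_{i,n}\sim P_1$ for $i>\xi_n$; put $\mathbf X=(X_{1,n},\dots,X_{n,n})$. Assume that $\xi_n/n\to\tau$ for some $\tau\in(0,1)$. Let $\mathcal D'_n$ be a random element (a dataset) independent of $\mathbf X$, and let $\hat\ell_n:\mathcal X\to\mathbb R$ be an estimate of $\ell$ learned on $\mathcal D'_n$ (that is, $\hat\ell_n(x)$ is a jointly measurable function of $\mathcal D_n'$ and $x$) such that, for $P\in\{P_0,P_1\}$, $$\mathbb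 E_{\mathcal D'_n,\;X\sim P,\;X\perp\mathcal D'_n}\bigl[|\hat\ell_n(X)-\ell(X)|^2\bigr]\longrightarrow 0\qquad(n\to\infty).$$ For $\mathbf x\in\mathcal X^n$ let $\hat\xi_n(\mathbf x)\in\operatorname{argmax}_{s\in[n-1]}\sum_{i=1}^{s}\hat\ell_n(x_i)$ (any choice of a maximizer), and for $t\in[n-1]$ define the score $$S_t(\mathbf x)=\begin{cases}\displaystyle\sum_{i=t+1}^{\hat\xi_n(\mathbf x)}-\hat\ell_n(x_i), & t\le\hat\xi_n(\mathbf x),\\[2mm] \displaystyle\sum_{i=\hat\xi_n(\mathbf x)+1}^{t}\hat\ell_n(x_i), & t>\hat\xi_n(\mathbf x).\end{cases}$$ Let $\Pi_t$ be the set of permutations $\pi$ of $[n]$ with $\pi(i)\le t$ for all $i\le t$ and $\pi(i)>t$ for all $i>t$, let $\pi(\mathbf x)=(x_{\pi(1)},\dots,x_{\pi(n)})$, and set $$p_{t,n}=\frac1{|\Pi_t|}\sum_{\pi\in\Pi_t}\mathbf 1\{S_t(\pi(\mathbf X))\le S_t(\mathbf X)\},\qquad \mathcal C_{n,1-\alpha}=\{t\in[n-1]:\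 p_{t,n}>\alpha\}.$$ Then for every $\alpha\in(0,1)$, $\ |\mathcal C_{n,1-\alpha}|/(n-1)\to0$ in probability as $n\to\infty$. -/

import Mathlib

open MeasureTheory ProbabilityTheory Filter Topology
open scoped NNReal ENNReal

/-! Positions `1, …, n` of a sample `x : Fin n → 𝒳` are numbered from one: the entry `x i` with
`i : Fin n` stands at position `(i : ℕ) + 1`. Candidate changepoints are the elements of
`Finset.Icc 1 (n - 1)`. -/

namespace Conch

/-- The split-permutation group `Π_t`: permutations of the `n` positions which map positions `≤ t`
to positions `≤ t` and positions `> t` to positions `> t`. -/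
def splitPerms (n t : ℕ) : Finset (Equiv.Perm (Fin n)) :=
  Finset.univ.filter fun π =>
    (∀ i : Fin n, (i : ℕ) + 1 ≤ t → (π i : ℕ) + 1 ≤ t) ∧
      (∀ i : Fin n, t < (i : ℕ) + 1 → t < (π i : ℕ) + 1)

open scoped Classical in
/-- The conformal p-value `p_t` at `x` of a score `S`, where `S x t` is the score of the
candidate `t`. The permuted sample `π(x) = (x_{π(1)}, …, x_{π(n)})` is `x ∘ π`. -/
noncomputable def pValue {𝒳 : Type*} {n : ℕ} (S : (Fin n → 𝒳) → ℕ → ℝ) (x : Fin n → 𝒳)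
    (t : ℕ) : ℝ :=
  (((splitPerms n t).filter fun π : Equiv.Perm (Fin n) => S (x ∘ ⇑π) t ≤ S x t).card : ℝ) /
    ((splitPerms n t).card : ℝ)

open scoped Classical in
/-- The CONCH confidence set `{t ∈ [n - 1] : p_t > α}`. -/
noncomputable def confSet {𝒳 : Type*} {n : ℕ} (S : (Fin n → 𝒳) → ℕ → ℝ) (α : ℝ)
    (x : Fin n → 𝒳) : Finset ℕ :=
  (Finset.Icc 1 (n - 1)).filter fun t : ℕ => α < pValue S x t

/-- `∑_{i = a + 1}^{b} g (x_i)`. -/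
def blockSum {𝒳 : Type*} {n : ℕ} (g : 𝒳 → ℝ) (x : Fin n → 𝒳) (a b : ℕ) : ℝ :=
  ∑ i ∈ Finset.univ.filter (fun i : Fin n => a < (i : ℕ) + 1 ∧ (i : ℕ) + 1 ≤ b), g (x i)

/-- `s` is a maximizer over `[n - 1]` of `s ↦ ∑_{i = 1}^{s} g (x_i)`. -/
def IsMLE {𝒳 : Type*} {n : ℕ} (g : 𝒳 → ℝ) (x : Fin n → 𝒳) (s : ℕ) : Prop :=
  s ∈ Finset.Icc 1 (n - 1) ∧
    ∀ r ∈ Finset.Icc 1 (n - 1), blockSum g x 0 r ≤ blockSum g x 0 s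

/-- The log-likelihood-ratio score built from a function `g` (an estimate of the log-likelihood
ratio) and a changepoint estimator `ξhat`, which is re-evaluated at the sample at hand. -/
def llrScore {𝒳 : Type*} {n : ℕ} (g : 𝒳 → ℝ) (ξhat : (Fin n → 𝒳) → ℕ) (x : Fin n → 𝒳)
    (t : ℕ) : ℝ :=
  if t ≤ ξhat x then - blockSum g x t (ξhat x) else blockSum g x (ξhat x) t

/-- The log-likelihood ratio `ℓ = log (f₀ / f₁)`. -/
noncomputable def logLR {𝒳 : Type*} (f₀ f₁ : 𝒳 → ℝ≥0) (x : 𝒳) : ℝ :=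
  Real.log ((f₀ x : ℝ) / (f₁ x : ℝ))

/-- The i.i.d. changepoint model: `X_1, …, X_n` are independent, `X_1, …, X_ξ` have law `P₀`, and
`X_{ξ + 1}, …, X_n` have law `P₁`. -/
structure IsIIDChangepoint {Ω 𝒳 : Type*} [MeasurableSpace Ω] [MeasurableSpace 𝒳] {n : ℕ}
    (X : Fin n → Ω → 𝒳) (μ : Measure Ω) (P₀ P₁ : Measure 𝒳) (ξ : ℕ) : Prop where
  mem : ξ ∈ Finset.Icc 1 (n - 1)
  indep : iIndepFun X μ
  law_pre : ∀ i : Fin n, (i : ℕ) + 1 ≤ ξ → HasLaw (X i) P₀ μ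
  law_post : ∀ i : Fin n, ξ < (i : ℕ) + 1 → HasLaw (X i) P₁ μ

end Conch

namespace Conch

/-! ### Sampling without replacement from a finite population. -/

section Permutations

variable {ι : Type*}

/-! Write `L` for the partial-sum profile of the learned log-likelihood ratio. The score at `t` is
`L t - max L` (`llrScore_eq`), and a split permutation at `t` fixes `L t`. Hence the p-value is the
proportion of split permutations whose shuffled profile has a maximum at least as high as the
original one.

A shuffled profile follows the chords joining its values at `0`, `t` and `n`, so its maximum is
about `max (0, L t, L n)`. The true profile has drift `m₀ > 0` before `ξ` and `m₁ < 0` after it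
(`integral_logLR_pos`). For `t` at distance of order `n` from `ξ`, the original maximum therefore
exceeds all three values by order `n`, while the fluctuations are smaller, and the p-value falls
below `α`. Only a small fraction of candidates remains.

Maximal inequalities are replaced by second moments. For permutations, one high value forces a whole
window of high values (`card_splitPerms_exceed_le`); for the data, Chebyshev counts the bad
candidates (`card_confSet_le`). By Cauchy–Schwarz, the learning error perturbs every partial sum by
at most the root of `n` times the total squared error, which no permutation changes
(`pValue_mul_le`). The estimates are deterministic on an event whose complement is controlled in
`IsIIDChangepoint.measure_card_confSet_le`. -/

theorem sum_comp_perm_of_mapsTo (B : Finset ι) (π : Equiv.Perm ι) (hmap : ∀ i ∈ B, π i ∈ B)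
    (f : ι → ℝ) : ∑ i ∈ B, f (π i) = ∑ i ∈ B, f i := by
  refine Finset.sum_bij (fun k _ => π k) hmap (fun _ _ _ _ h => π.injective h)
    (fun b hb => ?_) (fun _ _ => rfl)
  obtain ⟨a, ha, h⟩ := Finset.surj_on_of_inj_on_of_card_le (s := B) (t := B)
    (fun k _ => π k) hmap (fun _ _ _ _ h => π.injective h) le_rfl b hb
  exact ⟨a, ha, h.symm⟩

variable [DecidableEq ι]

/-- Sampling without replacement has nonpositive covariances. -/
theorem sum_perm_mul_nonpos (G : Finset (Equiv.Perm ι)) (B : Finset ι)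
    (hmap : ∀ π ∈ G, ∀ i ∈ B, π i ∈ B)
    (hswap : ∀ π ∈ G, ∀ j ∈ B, ∀ k ∈ B, π * Equiv.swap j k ∈ G)
    (f : ι → ℝ) (hf : ∑ i ∈ B, f i = 0) {i j : ι} (hi : i ∈ B) (hj : j ∈ B) (hij : i ≠ j) :
    ∑ π ∈ G, f (π i) * f (π j) ≤ 0 := by
  have hsum : ∀ π ∈ G, ∑ k ∈ B, f (π k) = 0 := by
    intro π hπ
    rw [sum_comp_perm_of_mapsTo B π (hmap π hπ) f, hf]
  -- Right multiplication by the transposition of `j` and `k` permutes `G` and fixes the image of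
  -- `i`, so all cross moments with `i` coincide.
  have hconst : ∀ k ∈ B.erase i, ∑ π ∈ G, f (π i) * f (π k) = ∑ π ∈ G, f (π i) * f (π j) := by
    intro k hk
    obtain ⟨hki, hkB⟩ := Finset.mem_erase.1 hk
    refine Finset.sum_bij (fun π _ => π * Equiv.swap j k)
      (fun π hπ => hswap π hπ j hj k hkB) (fun _ _ _ _ h => mul_right_cancel h)
      (fun π hπ => ⟨π * Equiv.swap j k, hswap π hπ j hj k hkB, by simp [mul_assoc]⟩) ?_
    intro π _
    simp [Equiv.swap_apply_of_ne_of_ne hij hki.symm]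
  -- The population sums to zero, so the nonnegative diagonal term and the `B.card - 1` equal cross
  -- moments cancel.
  have htot : ∑ k ∈ B, ∑ π ∈ G, f (π i) * f (π k) = 0 := by
    rw [Finset.sum_comm]
    refine Finset.sum_eq_zero fun π hπ => ?_
    rw [← Finset.mul_sum, hsum π hπ, mul_zero]
  rw [← Finset.add_sum_erase _ _ hi, Finset.sum_congr rfl hconst, Finset.sum_const,
    nsmul_eq_mul] at htot
  have h1 : 0 ≤ ∑ π ∈ G, f (π i) * f (π i) := Finset.sum_nonneg fun π _ => mul_self_nonneg _
  have h2 : (0 : ℝ) < ((B.erase i).card : ℝ) := by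
    exact_mod_cast Finset.card_pos.2 ⟨j, Finset.mem_erase.2 ⟨hij.symm, hj⟩⟩
  by_contra! h
  nlinarith [mul_pos h2 h]

/-- Second-moment bound for sampling without replacement from a finite population. -/
theorem sum_perm_sq_le (G : Finset (Equiv.Perm ι)) (B : Finset ι)
    (hmap : ∀ π ∈ G, ∀ i ∈ B, π i ∈ B)
    (hswap : ∀ π ∈ G, ∀ j ∈ B, ∀ k ∈ B, π * Equiv.swap j k ∈ G)
    (b : ι → ℝ) {A : Finset ι} (hA : A ⊆ B) :
    ∑ π ∈ G, (∑ i ∈ A, b (π i) - A.card / B.card * ∑ i ∈ B, b i) ^ 2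
      ≤ G.card * ∑ i ∈ B, b i ^ 2 := by
  rcases B.eq_empty_or_nonempty with rfl | hB
  · obtain rfl := Finset.subset_empty.1 hA
    simp
  have hc : (0 : ℝ) < B.card := by exact_mod_cast Finset.card_pos.2 hB
  set m : ℝ := (∑ i ∈ B, b i) / B.card with hm
  set f : ι → ℝ := fun i => b i - m with hf
  have hBm : ∑ i ∈ B, b i = B.card * m := by rw [hm]; field_simp
  have hf0 : ∑ i ∈ B, f i = 0 := by
    simp only [hf, Finset.sum_sub_distrib, Finset.sum_const, nsmul_eq_mul, hBm, sub_self]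
  have hcentre : ∀ π : Equiv.Perm ι,
      ∑ i ∈ A, b (π i) - A.card / B.card * ∑ i ∈ B, b i = ∑ i ∈ A, f (π i) := by
    intro π
    simp only [hf, Finset.sum_sub_distrib, Finset.sum_const, nsmul_eq_mul, hBm]
    rw [div_mul_eq_mul_div, mul_left_comm, mul_div_cancel_left₀ _ hc.ne']
  have hfb : ∑ i ∈ B, f i ^ 2 ≤ ∑ i ∈ B, b i ^ 2 := by
    have : ∑ i ∈ B, f i ^ 2 = ∑ i ∈ B, b i ^ 2 - B.card * m ^ 2 := by
      simp only [hf, sub_sq, Finset.sum_add_distrib, Finset.sum_sub_distrib, Finset.sum_const,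
        nsmul_eq_mul, ← Finset.sum_mul, ← Finset.mul_sum, hBm]
      ring
    rw [this]
    nlinarith [mul_nonneg hc.le (sq_nonneg m)]
  calc ∑ π ∈ G, (∑ i ∈ A, b (π i) - A.card / B.card * ∑ i ∈ B, b i) ^ 2
      = ∑ i ∈ A, ∑ j ∈ A, ∑ π ∈ G, f (π i) * f (π j) := by
        simp_rw [hcentre, sq, Finset.sum_mul_sum]
        rw [Finset.sum_comm]
        refine Finset.sum_congr rfl fun i _ => ?_
        rw [Finset.sum_comm]
    _ ≤ ∑ i ∈ A, ∑ π ∈ G, f (π i) ^ 2 := by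
        refine Finset.sum_le_sum fun i hi => ?_
        rw [← Finset.add_sum_erase _ _ hi]
        have : ∑ j ∈ A.erase i, ∑ π ∈ G, f (π i) * f (π j) ≤ 0 :=
          Finset.sum_nonpos fun j hj => sum_perm_mul_nonpos G B hmap hswap f hf0 (hA hi)
            (hA (Finset.mem_of_mem_erase hj)) (Finset.ne_of_mem_erase hj).symm
        simp_rw [sq]
        linarith
    _ ≤ ∑ i ∈ B, ∑ π ∈ G, f (π i) ^ 2 :=
        Finset.sum_le_sum_of_subset_of_nonneg hA fun _ _ _ =>
          Finset.sum_nonneg fun _ _ => sq_nonneg _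
    _ = G.card * ∑ i ∈ B, f i ^ 2 := by
        rw [Finset.sum_comm, Finset.sum_congr rfl fun π hπ =>
          sum_comp_perm_of_mapsTo B π (hmap π hπ) fun i => f i ^ 2]
        simp
    _ ≤ G.card * ∑ i ∈ B, b i ^ 2 := mul_le_mul_of_nonneg_left hfb (Nat.cast_nonneg _)

end Permutations

/-! ### Partial sums and their oscillation. -/

section PrefixSums

variable {n : ℕ}

/-- The partial sum of the first `s` entries. -/
def prefixSum (b : Fin n → ℝ) (s : ℕ) : ℝ :=
  ∑ i ∈ Finset.univ.filter (fun i : Fin n => (i : ℕ) < s), b i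

theorem blockSum_zero_eq_prefixSum {𝒳 : Type*} (g : 𝒳 → ℝ) (x : Fin n → 𝒳) (s : ℕ) :
    blockSum g x 0 s = prefixSum (fun i => g (x i)) s := by
  unfold blockSum prefixSum
  congr 1
  ext i
  simp

theorem prefixSum_add_sum (b : Fin n → ℝ) {s r : ℕ} (h : s ≤ r) :
    prefixSum b s + ∑ i ∈ Finset.univ.filter (fun i : Fin n => s ≤ (i : ℕ) ∧ (i : ℕ) < r), b i
      = prefixSum b r := by
  unfold prefixSum
  rw [← Finset.sum_union]
  · congr 1
    ext i
    simp only [Finset.mem_union, Finset.mem_filter, Finset.mem_univ, true_and]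
    omega
  · rw [Finset.disjoint_left]
    intro i
    simp only [Finset.mem_filter, Finset.mem_univ, true_and]
    omega

theorem prefixSum_sub (a b : Fin n → ℝ) (s : ℕ) :
    prefixSum (fun i => a i - b i) s = prefixSum a s - prefixSum b s := by
  simp [prefixSum, Finset.sum_sub_distrib]

theorem prefixSum_zero (b : Fin n → ℝ) : prefixSum b 0 = 0 := by simp [prefixSum]

theorem blockSum_eq_sub {𝒳 : Type*} (g : 𝒳 → ℝ) (x : Fin n → 𝒳) {s r : ℕ} (h : s ≤ r) :
    blockSum g x s r = prefixSum (fun i => g (x i)) r - prefixSum (fun i => g (x i)) s := by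
  rw [← prefixSum_add_sum _ h, add_sub_cancel_left]
  unfold blockSum
  congr 1
  ext i
  simp

theorem card_filter_between (s r : ℕ) (hr : r ≤ n) :
    (Finset.univ.filter (fun i : Fin n => s ≤ (i : ℕ) ∧ (i : ℕ) < r)).card = r - s := by
  rw [← Nat.card_Ico, ← Finset.card_map Fin.valEmbedding]
  congr 1
  ext k
  simp only [Finset.mem_map, Finset.mem_filter, Finset.mem_univ, true_and, Fin.valEmbedding_apply,
    Finset.mem_Ico]
  constructor
  · rintro ⟨i, h, rfl⟩
    exact h
  · intro h
    exact ⟨⟨k, by omega⟩, h, rfl⟩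

theorem card_filter_lt (r : ℕ) (hr : r ≤ n) :
    (Finset.univ.filter (fun i : Fin n => (i : ℕ) < r)).card = r := by
  simpa using card_filter_between (n := n) 0 r hr

/-- Cauchy–Schwarz bound for the oscillation of partial sums. -/
theorem sq_prefixSum_sub_le (b : Fin n → ℝ) {s r : ℕ} (h : s ≤ r) (hr : r ≤ n) :
    (prefixSum b r - prefixSum b s) ^ 2 ≤ (r - s : ℕ) * ∑ i, b i ^ 2 := by
  rw [← prefixSum_add_sum b h, add_sub_cancel_left]
  refine (sq_sum_le_card_mul_sum_sq).trans ?_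
  rw [card_filter_between s r hr]
  gcongr
  exact Finset.filter_subset _ _

theorem sum_sq_comp_perm (b : Fin n → ℝ) (π : Equiv.Perm (Fin n)) :
    ∑ i, b (π i) ^ 2 = ∑ i, b i ^ 2 :=
  Equiv.sum_comp π fun i => b i ^ 2

end PrefixSums

/-! ### Maxima of partial sums under split permutations. -/

section SplitPerms

variable {n t : ℕ}

theorem mem_splitPerms {π : Equiv.Perm (Fin n)} :
    π ∈ splitPerms n t ↔
      (∀ i : Fin n, (i : ℕ) < t → (π i : ℕ) < t) ∧ ∀ i : Fin n, t ≤ (i : ℕ) → t ≤ (π i : ℕ) := by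
  simp [splitPerms]

theorem splitPerms_card_pos : 0 < (splitPerms n t).card :=
  Finset.card_pos.2 ⟨1, by simp [mem_splitPerms]⟩

theorem mul_swap_mem_splitPerms {π : Equiv.Perm (Fin n)} (hπ : π ∈ splitPerms n t) {j k : Fin n}
    (h : (j : ℕ) < t ↔ (k : ℕ) < t) : π * Equiv.swap j k ∈ splitPerms n t := by
  rw [mem_splitPerms] at hπ ⊢
  have key : ∀ i, (Equiv.swap j k i : ℕ) < t ↔ (i : ℕ) < t := by
    intro i
    rw [Equiv.swap_apply_def]
    split_ifs with h1 h2
    · rw [h1, h]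
    · rw [h2, h]
    · rfl
  refine ⟨fun i hi => hπ.1 _ ((key i).2 hi), fun i hi => hπ.2 _ ?_⟩
  have := key i
  omega

theorem prefixSum_comp_splitPerm (b : Fin n → ℝ) {π : Equiv.Perm (Fin n)}
    (hπ : π ∈ splitPerms n t) : prefixSum (fun i => b (π i)) t = prefixSum b t :=
  sum_comp_perm_of_mapsTo _ π
    (fun i hi => by simpa using (mem_splitPerms.1 hπ).1 i (by simpa using hi)) b

/-- The mean of a shuffled partial sum lies on a chord between two block end values, hence below any
common upper bound of them. -/
theorem interpolation_le {u v q m : ℝ} (hq0 : 0 ≤ q) (hq1 : q ≤ 1) (hu : u ≤ m) (hv : v ≤ m) :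
    u + q * (v - u) ≤ m := by nlinarith

/-- Under a uniform split permutation, every partial sum stays below the maximum of `0` and the
two block end values, up to an error controlled in quadratic mean. -/
theorem sum_splitPerms_sq_le (b : Fin n → ℝ) (ht : t ≤ n) (s : ℕ) {m : ℝ}
    (hm0 : 0 ≤ m) (hmt : prefixSum b t ≤ m) (hmn : prefixSum b n ≤ m) :
    ∑ π ∈ splitPerms n t, max (prefixSum (fun i => b (π i)) s - m) 0 ^ 2
      ≤ (splitPerms n t).card * ∑ i, b i ^ 2 := by
  -- The excess over `m` is at most the deviation from any centre `w ≤ m`; below, `w` is the point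
  -- on the chord.
  have hmax : ∀ {u w : ℝ}, w ≤ m → max (u - m) 0 ^ 2 ≤ (u - w) ^ 2 := by
    intro u w hw
    rcases le_total (u - m) 0 with h | h
    · rw [max_eq_right h, zero_pow two_ne_zero]
      exact sq_nonneg _
    · rw [max_eq_left h]; nlinarith
  rcases le_or_gt s t with hst | hst
  · set B := Finset.univ.filter (fun i : Fin n => (i : ℕ) < t) with hB
    set A := Finset.univ.filter (fun i : Fin n => (i : ℕ) < s) with hAdef
    have hAB : A ⊆ B := by
      intro i
      simp only [hB, hAdef, Finset.mem_filter, Finset.mem_univ, true_and]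
      omega
    have key := sum_perm_sq_le (splitPerms n t) B
      (fun π hπ i hi => by
        simpa [hB] using (mem_splitPerms.1 hπ).1 i (by simpa [hB] using hi))
      (fun π hπ j hj k hk => mul_swap_mem_splitPerms hπ (by
        simp only [hB, Finset.mem_filter, Finset.mem_univ, true_and] at hj hk
        omega)) b hAB
    refine (Finset.sum_le_sum fun π _ => ?_).trans (key.trans ?_)
    · refine hmax ?_
      have : (A.card : ℝ) / B.card * ∑ i ∈ B, b i =
          0 + (A.card : ℝ) / B.card * (prefixSum b t - 0) := by
        simp [prefixSum, hB]
      rw [this]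
      exact interpolation_le (by positivity)
        (div_le_one_of_le₀ (by exact_mod_cast Finset.card_le_card hAB) (by positivity)) hm0 hmt
    · gcongr
      exact Finset.filter_subset _ _
  · set B := Finset.univ.filter (fun i : Fin n => t ≤ (i : ℕ) ∧ (i : ℕ) < n) with hB
    set A := Finset.univ.filter (fun i : Fin n => t ≤ (i : ℕ) ∧ (i : ℕ) < s) with hAdef
    have hAB : A ⊆ B := by
      intro i
      simp only [hB, hAdef, Finset.mem_filter, Finset.mem_univ, true_and]
      omega
    have key := sum_perm_sq_le (splitPerms n t) B
      (fun π hπ i hi => by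
        simpa [hB] using (mem_splitPerms.1 hπ).2 i (by simpa [hB] using hi))
      (fun π hπ j hj k hk => mul_swap_mem_splitPerms hπ (by
        simp only [hB, Finset.mem_filter, Finset.mem_univ, true_and] at hj hk
        omega)) b hAB
    refine (Finset.sum_le_sum fun π hπ => ?_).trans (key.trans ?_)
    · have h1 : ∑ i ∈ B, b i = prefixSum b n - prefixSum b t := by
        rw [← prefixSum_add_sum b ht, add_sub_cancel_left]
      have h2 : ∑ i ∈ A, b (π i) = prefixSum (fun i => b (π i)) s - prefixSum b t := by
        rw [← prefixSum_comp_splitPerm b hπ, ← prefixSum_add_sum _ hst.le, add_sub_cancel_left]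
      rw [h1, h2, sub_sub]
      exact hmax (interpolation_le (by positivity)
        (div_le_one_of_le₀ (by exact_mod_cast Finset.card_le_card hAB) (by positivity)) hmt hmn)
    · gcongr
      exact Finset.filter_subset _ _

open scoped Classical in
/-- Few split permutations push some partial sum well above the maximum of `0` and the two block
end values. -/
theorem card_splitPerms_exceed_le (b : Fin n → ℝ) (ht : t ≤ n) {m c : ℝ} (hc : 0 < c)
    (hm0 : 0 ≤ m) (hmt : prefixSum b t ≤ m) (hmn : prefixSum b n ≤ m) {h : ℕ}
    (hh : h * ∑ i, b i ^ 2 ≤ c ^ 2) :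
    ((splitPerms n t).filter fun π : Equiv.Perm (Fin n) =>
        ∃ s ≤ n, m + 2 * c ≤ prefixSum (fun i => b (π i)) s).card * (h * c ^ 2)
      ≤ (splitPerms n t).card * ((n + 1) * ∑ i, b i ^ 2) := by
  set v := ∑ i, b i ^ 2 with hv
  have hv0 : 0 ≤ v := Finset.sum_nonneg fun _ _ => sq_nonneg _
  -- The sum of squares is invariant under permutation, so the oscillation over windows of length at
  -- most `h` is at most `c` for every `π` at once.
  have hosc : ∀ (π : Equiv.Perm (Fin n)) {s r : ℕ}, s ≤ r → r ≤ n → r - s ≤ h →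
      prefixSum (fun i => b (π i)) r - c ≤ prefixSum (fun i => b (π i)) s := by
    intro π s r hsr hr hd
    have h1 := sq_prefixSum_sub_le (fun i => b (π i)) hsr hr
    rw [sum_sq_comp_perm b π] at h1
    have h2 : ((r - s : ℕ) : ℝ) * v ≤ h * v := by gcongr
    have := abs_le_of_sq_le_sq (h1.trans (h2.trans hh)) hc.le
    linarith [(abs_le.1 this).2]
  -- An excess of `2 * c` at `s` leaves an excess of at least `c` at each of the `h` indices ending
  -- at `s`.
  have hpt : ∀ π : Equiv.Perm (Fin n), (∃ s ≤ n, m + 2 * c ≤ prefixSum (fun i => b (π i)) s) →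
      h * c ^ 2 ≤ ∑ s ∈ Finset.range (n + 1), max (prefixSum (fun i => b (π i)) s - m) 0 ^ 2 := by
    rintro π ⟨s, hs, hms⟩
    -- The window does not run past `0`: the profile vanishes there, and within `h` steps it could
    -- rise by at most `c`, short of `m + 2 * c`.
    have hsh : h ≤ s := by
      by_contra! hlt
      have := hosc π (Nat.zero_le s) hs (by omega)
      rw [prefixSum_zero] at this
      linarith
    calc (h : ℝ) * c ^ 2 = ∑ r ∈ Finset.Ioc (s - h) s, c ^ 2 := by
          rw [Finset.sum_const, nsmul_eq_mul, Nat.card_Ioc, Nat.sub_sub_self hsh]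
      _ ≤ ∑ r ∈ Finset.Ioc (s - h) s, max (prefixSum (fun i => b (π i)) r - m) 0 ^ 2 := by
          refine Finset.sum_le_sum fun r hr => ?_
          rw [Finset.mem_Ioc] at hr
          have := hosc π hr.2 hs (by omega)
          exact pow_le_pow_left₀ hc.le (le_max_of_le_left (by linarith)) 2
      _ ≤ _ := by
          refine Finset.sum_le_sum_of_subset_of_nonneg (fun r hr => ?_) fun _ _ _ => sq_nonneg _
          rw [Finset.mem_Ioc] at hr
          rw [Finset.mem_range]
          omega
  calc _ = ∑ π ∈ (splitPerms n t).filter fun π : Equiv.Perm (Fin n) =>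
        ∃ s ≤ n, m + 2 * c ≤ prefixSum (fun i => b (π i)) s, (h : ℝ) * c ^ 2 := by
        rw [Finset.sum_const, nsmul_eq_mul]
    _ ≤ ∑ π ∈ (splitPerms n t).filter fun π : Equiv.Perm (Fin n) =>
        ∃ s ≤ n, m + 2 * c ≤ prefixSum (fun i => b (π i)) s,
        ∑ s ∈ Finset.range (n + 1), max (prefixSum (fun i => b (π i)) s - m) 0 ^ 2 :=
        Finset.sum_le_sum fun π hπ => hpt π (Finset.mem_filter.1 hπ).2
    _ ≤ ∑ π ∈ splitPerms n t,
        ∑ s ∈ Finset.range (n + 1), max (prefixSum (fun i => b (π i)) s - m) 0 ^ 2 :=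
        Finset.sum_le_sum_of_subset_of_nonneg (Finset.filter_subset _ _) fun _ _ _ =>
          Finset.sum_nonneg fun _ _ => sq_nonneg _
    _ ≤ ∑ s ∈ Finset.range (n + 1), (splitPerms n t).card * v := by
        rw [Finset.sum_comm]
        exact Finset.sum_le_sum fun s _ => sum_splitPerms_sq_le b ht s hm0 hmt hmn
    _ = _ := by
        rw [Finset.sum_const, nsmul_eq_mul, Finset.card_range]
        push_cast
        ring

end SplitPerms

/-! ### Deterministic control of the p-value. -/

section PValue

variable {𝒳 : Type*} {n t : ℕ}

/-- The score of `t` is the log-likelihood at `t` minus the maximal log-likelihood. -/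
theorem llrScore_eq (g : 𝒳 → ℝ) (ξhat : (Fin n → 𝒳) → ℕ) (x : Fin n → 𝒳) (t : ℕ) :
    llrScore g ξhat x t =
      prefixSum (fun i => g (x i)) t - prefixSum (fun i => g (x i)) (ξhat x) := by
  unfold llrScore
  split_ifs with h
  · rw [blockSum_eq_sub g x h, neg_sub]
  · rw [blockSum_eq_sub g x (not_le.1 h).le]

theorem abs_prefixSum_sub_le (a b : Fin n → ℝ) {s : ℕ} (hs : s ≤ n) {c : ℝ} (hc : 0 ≤ c)
    (h : n * ∑ i, (a i - b i) ^ 2 ≤ c ^ 2) : |prefixSum a s - prefixSum b s| ≤ c := by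
  rw [← prefixSum_sub]
  refine abs_le_of_sq_le_sq ?_ hc
  have h1 := sq_prefixSum_sub_le (fun i => a i - b i) (Nat.zero_le s) hs
  rw [prefixSum_zero, sub_zero, Nat.sub_zero] at h1
  refine h1.trans (le_trans ?_ h)
  gcongr

/-- Deterministic bound on the p-value at a candidate `t` whose profile value `prefixSum ℓ t` and
whose end values `0`, `prefixSum ℓ n` lie below `prefixSum ℓ r` for some candidate `r`. -/
theorem pValue_mul_le (g ℓ : 𝒳 → ℝ) (ξhat : (Fin n → 𝒳) → ℕ) (hξ : ∀ x, IsMLE g x (ξhat x))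
    (x : Fin n → 𝒳) (ht : t ≤ n) {r : ℕ} (hr : r ∈ Finset.Icc 1 (n - 1)) {c : ℝ} (hc : 0 < c)
    (herr : n * ∑ i, (g (x i) - ℓ (x i)) ^ 2 ≤ c ^ 2)
    (h0 : 4 * c ≤ prefixSum (fun i => ℓ (x i)) r)
    (hpt : prefixSum (fun i => ℓ (x i)) t + 4 * c ≤ prefixSum (fun i => ℓ (x i)) r)
    (hpn : prefixSum (fun i => ℓ (x i)) n + 4 * c ≤ prefixSum (fun i => ℓ (x i)) r)
    {h : ℕ} (hh : h * ∑ i, ℓ (x i) ^ 2 ≤ c ^ 2) :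
    pValue (llrScore g ξhat) x t * (h * c ^ 2) ≤ (n + 1) * ∑ i, ℓ (x i) ^ 2 := by
  classical
  set b : Fin n → ℝ := fun i => ℓ (x i) with hb
  have hrn : r ≤ n := by rw [Finset.mem_Icc] at hr; omega
  -- Of the margin `4 * c`, two units absorb the replacement of `g` by `ℓ`, once at `r` and once at
  -- the permuted maximizer; the other two are the excess to be counted.
  have hcount := card_splitPerms_exceed_le b ht (m := prefixSum b r - 4 * c) hc (by linarith)
    (by linarith) (by linarith) hh
  have hcard : (0 : ℝ) < (splitPerms n t).card := by exact_mod_cast splitPerms_card_pos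
  have hsub : ((splitPerms n t).filter fun π : Equiv.Perm (Fin n) =>
      llrScore g ξhat (x ∘ ⇑π) t ≤ llrScore g ξhat x t) ⊆
      (splitPerms n t).filter fun π : Equiv.Perm (Fin n) =>
        ∃ s ≤ n, prefixSum b r - 4 * c + 2 * c ≤ prefixSum (fun i => b (π i)) s := by
    intro π hπ
    rw [Finset.mem_filter] at hπ ⊢
    obtain ⟨hπ, hle⟩ := hπ
    refine ⟨hπ, ξhat (x ∘ π), ?_, ?_⟩
    · have := Finset.mem_Icc.1 (hξ (x ∘ π)).1
      omega
    have hs : ξhat (x ∘ π) ≤ n := by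
      have := Finset.mem_Icc.1 (hξ (x ∘ π)).1
      omega
    rw [llrScore_eq, llrScore_eq] at hle
    have hinv : prefixSum (fun i => g ((x ∘ π) i)) t = prefixSum (fun i => g (x i)) t :=
      prefixSum_comp_splitPerm (fun i => g (x i)) hπ
    have hmle := (hξ x).2 r hr
    rw [blockSum_zero_eq_prefixSum, blockSum_zero_eq_prefixSum] at hmle
    have h1 := abs_prefixSum_sub_le (fun i => g (x i)) b hrn hc.le herr
    -- The total squared error is symmetric in the sample, so `herr` also controls the permuted
    -- sample.
    have h2 := abs_prefixSum_sub_le (fun i => g ((x ∘ π) i)) (fun i => b (π i)) hs hc.le (by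
      rw [← Equiv.sum_comp π] at herr
      exact herr)
    rw [abs_le] at h1 h2
    linarith [h1.1, h2.2]
  have hle : (((splitPerms n t).filter fun π : Equiv.Perm (Fin n) =>
      llrScore g ξhat (x ∘ ⇑π) t ≤ llrScore g ξhat x t).card : ℝ) * (h * c ^ 2) ≤
      (splitPerms n t).card * ((n + 1) * ∑ i, b i ^ 2) :=
    le_trans (by gcongr) hcount
  unfold pValue
  rw [div_mul_eq_mul_div, div_le_iff₀ hcard, mul_comm _ ((splitPerms n t).card : ℝ)]
  convert hle using 3

end PValue

end Conch

namespace Conch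

/-! ### Deterministic control of the confidence set. -/

section Deterministic

variable {n : ℕ}

/-- The mean of the log-likelihood ratio at each position of a changepoint sample. -/
def stepMean (n ξ : ℕ) (m₀ m₁ : ℝ) (i : Fin n) : ℝ := if (i : ℕ) < ξ then m₀ else m₁

theorem prefixSum_stepMean_of_le {ξ s : ℕ} (m₀ m₁ : ℝ) (hs : s ≤ ξ) (hξ : ξ ≤ n) :
    prefixSum (stepMean n ξ m₀ m₁) s = s * m₀ := by
  unfold prefixSum
  rw [Finset.sum_congr rfl (g := fun _ => m₀), Finset.sum_const, nsmul_eq_mul,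
    card_filter_lt s (hs.trans hξ)]
  intro i hi
  rw [Finset.mem_filter] at hi
  exact if_pos (by omega)

theorem prefixSum_stepMean_of_ge {ξ s : ℕ} (m₀ m₁ : ℝ) (hs : ξ ≤ s) (hsn : s ≤ n) :
    prefixSum (stepMean n ξ m₀ m₁) s = ξ * m₀ + (s - ξ) * m₁ := by
  rw [← prefixSum_add_sum _ hs, prefixSum_stepMean_of_le m₀ m₁ le_rfl (hs.trans hsn),
    Finset.sum_congr rfl (g := fun _ => m₁), Finset.sum_const, nsmul_eq_mul,
    card_filter_between ξ s hsn, Nat.cast_sub hs]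
  intro i hi
  rw [Finset.mem_filter] at hi
  exact if_neg (by omega)

/-- Deterministic bound on the size of the confidence set. -/
theorem card_confSet_le {𝒳 : Type*} (g ℓ : 𝒳 → ℝ) (ξhat : (Fin n → 𝒳) → ℕ)
    (hξhat : ∀ x, IsMLE g x (ξhat x)) (x : Fin n → 𝒳) {ξ : ℕ} (hξ : ξ ∈ Finset.Icc 1 (n - 1))
    {m₀ m₁ δ c α v : ℝ} {d h : ℕ} (hδ : 0 < δ) (hδ₀ : δ ≤ m₀) (hδ₁ : m₁ ≤ -δ) (hc : 0 < c)
    (hh0 : 0 < h)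
    (hleft : 6 * c ≤ ξ * δ) (hright : 6 * c ≤ (n - ξ) * δ) (hd : 6 * c ≤ d * δ)
    (herr : n * ∑ i, (g (x i) - ℓ (x i)) ^ 2 ≤ c ^ 2)
    (hv : ∑ i, ℓ (x i) ^ 2 ≤ v) (hh : h * v ≤ c ^ 2) (hp : (n + 1) * v ≤ α * (h * c ^ 2))
    (hYξ : |prefixSum (fun i => ℓ (x i) - stepMean n ξ m₀ m₁ i) ξ| ≤ c)
    (hYn : |prefixSum (fun i => ℓ (x i) - stepMean n ξ m₀ m₁ i) n| ≤ c) :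
    ((confSet (llrScore g ξhat) α x).card : ℝ) ≤ 2 * d +
      (∑ s ∈ Finset.range (n + 1),
        prefixSum (fun i => ℓ (x i) - stepMean n ξ m₀ m₁ i) s ^ 2) / c ^ 2 := by
  classical
  set Y : ℕ → ℝ := fun s => prefixSum (fun i => ℓ (x i) - stepMean n ξ m₀ m₁ i) s with hY
  obtain ⟨hξ1, hξn⟩ := Finset.mem_Icc.1 hξ
  have hξn' : ξ ≤ n := by omega
  have hYeq : ∀ s, prefixSum (fun i => ℓ (x i)) s = Y s + prefixSum (stepMean n ξ m₀ m₁) s := by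
    intro s
    simp only [hY]
    rw [prefixSum_sub]
    ring
  have hξR : (ξ : ℝ) ≤ n := by exact_mod_cast hξn'
  have hξ0 : (0 : ℝ) ≤ ξ := Nat.cast_nonneg _
  have hMξ := hYeq ξ
  rw [prefixSum_stepMean_of_le m₀ m₁ le_rfl hξn'] at hMξ
  have hMn := hYeq n
  rw [prefixSum_stepMean_of_ge m₀ m₁ hξn' le_rfl] at hMn
  have hYξ' := abs_le.1 (show |Y ξ| ≤ c from hYξ)
  have hYn' := abs_le.1 (show |Y n| ≤ c from hYn)
  have hgood : ∀ t ∈ Finset.Icc 1 (n - 1), (t + d ≤ ξ ∨ ξ + d ≤ t) → |Y t| ≤ c →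
      pValue (llrScore g ξhat) x t ≤ α := by
    intro t ht hfar hYt
    have htn : t ≤ n := by rw [Finset.mem_Icc] at ht; omega
    have hYt' := abs_le.1 hYt
    have hMt := hYeq t
    -- The drift gap `6 * c` pays for the margin `4 * c` and for noise of size `c` at each of `t`
    -- and `ξ`.
    have hgap : prefixSum (stepMean n ξ m₀ m₁) t + 6 * c ≤ ξ * m₀ := by
      rcases hfar with hfar | hfar
      · rw [prefixSum_stepMean_of_le m₀ m₁ (by omega) hξn']
        have : (t : ℝ) + d ≤ ξ := by exact_mod_cast hfar
        nlinarith
      · rw [prefixSum_stepMean_of_ge m₀ m₁ (by omega) htn]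
        have : (ξ : ℝ) + d ≤ t := by exact_mod_cast hfar
        nlinarith
    have hle := pValue_mul_le g ℓ ξhat hξhat x htn hξ hc herr (by nlinarith) (by linarith)
      (by nlinarith) (h := h) (le_trans (by gcongr) hh)
    have hpos : (0 : ℝ) < h * c ^ 2 := by positivity
    refine le_of_mul_le_mul_right (hle.trans (le_trans ?_ hp)) hpos
    gcongr
  have hsub : confSet (llrScore g ξhat) α x ⊆ Finset.Ico (ξ - d) (ξ + d) ∪
      (Finset.range (n + 1)).filter fun t => c < |Y t| := by
    intro t ht
    unfold confSet at ht
    obtain ⟨ht, hpt⟩ := Finset.mem_filter.1 ht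
    by_contra! hnot
    simp only [Finset.mem_union, Finset.mem_Ico, Finset.mem_filter, Finset.mem_range, not_or,
      not_and, not_lt] at hnot
    refine absurd (hgood t ht ?_ (hnot.2 ?_)) (not_le.2 hpt)
    · have := hnot.1
      omega
    · rw [Finset.mem_Icc] at ht
      omega
  have hcard1 : ((Finset.Ico (ξ - d) (ξ + d)).card : ℝ) ≤ 2 * d := by
    rw [Nat.card_Ico]
    have : ξ + d - (ξ - d) ≤ 2 * d := by omega
    exact_mod_cast this
  -- Chebyshev for the counting measure on candidates: the noise need not be uniformly small in `t`.
  have hcard2 : (((Finset.range (n + 1)).filter fun t => c < |Y t|).card : ℝ) ≤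
      (∑ s ∈ Finset.range (n + 1), Y s ^ 2) / c ^ 2 := by
    rw [le_div_iff₀ (by positivity), ← nsmul_eq_mul, ← Finset.sum_const]
    refine (Finset.sum_le_sum fun s hs => ?_).trans
      (Finset.sum_le_sum_of_subset_of_nonneg (Finset.filter_subset _ _) fun _ _ _ => sq_nonneg _)
    rw [← sq_abs (Y s)]
    exact pow_le_pow_left₀ hc.le (Finset.mem_filter.1 hs).2.le 2
  have hcard : ((confSet (llrScore g ξhat) α x).card : ℝ) ≤
      ((Finset.Ico (ξ - d) (ξ + d)).card : ℝ) +
        ((Finset.range (n + 1)).filter fun t => c < |Y t|).card := by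
    exact_mod_cast (Finset.card_le_card hsub).trans (Finset.card_union_le _ _)
  linarith

/-- The confidence set is a small fraction of the candidates on the event where the centred partial
sums, the sum of squares and the estimation error are of their typical order. -/
theorem card_confSet_div_lt {𝒳 : Type*} (g ℓ : 𝒳 → ℝ) (ξhat : (Fin n → 𝒳) → ℕ)
    (hξhat : ∀ x, IsMLE g x (ξhat x)) (x : Fin n → 𝒳) {ξ : ℕ} (hξ : ξ ∈ Finset.Icc 1 (n - 1))
    {m₀ m₁ δ ρ η α ε : ℝ} (hδ : 0 < δ) (hδ₀ : δ ≤ m₀) (hδ₁ : m₁ ≤ -δ)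
    (hα : 0 < α) (hα1 : α ≤ 1) (hε : 0 < ε) (hη : 0 < η) (hηρ : 6 * η ≤ ρ * δ)
    (hηε : 96 * η ≤ ε * δ) (hleft : ρ * n ≤ ξ) (hright : ρ * n ≤ n - ξ)
    (hn : 4 * (ε + 2) ≤ ε * n)
    (herr : ∑ i, (g (x i) - ℓ (x i)) ^ 2 ≤ η ^ 2 * n)
    (hv : ∑ i, ℓ (x i) ^ 2 ≤ η ^ 2 * α / 2 * (n * √n))
    (hYξ : prefixSum (fun i => ℓ (x i) - stepMean n ξ m₀ m₁ i) ξ ^ 2 ≤ (η * n) ^ 2)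
    (hYn : prefixSum (fun i => ℓ (x i) - stepMean n ξ m₀ m₁ i) n ^ 2 ≤ (η * n) ^ 2)
    (hQ : ∑ s ∈ Finset.range (n + 1),
        prefixSum (fun i => ℓ (x i) - stepMean n ξ m₀ m₁ i) s ^ 2 ≤ η ^ 2 * ε / 8 * (n : ℝ) ^ 3) :
    ((confSet (llrScore g ξhat) α x).card : ℝ) / (n - 1) < ε := by
  have hn2 : 2 ≤ n := by rw [Finset.mem_Icc] at hξ; omega
  have hnR : (2 : ℝ) ≤ n := by exact_mod_cast hn2
  have hn0 : (0 : ℝ) < n := by linarith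
  have hc : 0 < η * n := by positivity
  have hsq : √(n : ℝ) * √n = n := Real.mul_self_sqrt hn0.le
  have hs1 : 1 ≤ √(n : ℝ) := Real.one_le_sqrt.2 (by linarith)
  set u := √(n : ℝ) / α with hu
  have hu1 : 1 ≤ u := (one_le_div hα).2 (hα1.trans hs1)
  have huα : u * α = √(n : ℝ) := div_mul_cancel₀ _ hα.ne'
  -- Two demands meet at order `√n / α`: the window must be short for the oscillation bound (`h ≤ 2
  -- * u`) and long for the p-value bound (`u ≤ h`).
  set h : ℕ := ⌊2 * u⌋₊ with hh
  have hhle : (h : ℝ) ≤ 2 * u := Nat.floor_le (by linarith)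
  have hhge : u ≤ h := by
    have := Nat.lt_floor_add_one (2 * u)
    linarith
  set d : ℕ := ⌈6 * (η * n) / δ⌉₊ with hd
  have hdge : 6 * (η * n) / δ ≤ d := Nat.le_ceil _
  have hdlt : (d : ℝ) < 6 * (η * n) / δ + 1 := Nat.ceil_lt_add_one (by positivity)
  -- Since `96 = 6 * 16`, the neighbourhood of `ξ` costs at most `ε * n / 8 + 2` candidates and the
  -- noisy ones at most `ε * n / 8`; `hn` absorbs the rest.
  have hdle : 6 * (η * n) / δ ≤ ε / 16 * n := by
    rw [div_le_iff₀ hδ]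
    nlinarith
  have hnξ : 6 * (η * n) ≤ ρ * n * δ := by
    calc 6 * (η * n) = 6 * η * n := by ring
      _ ≤ ρ * δ * n := by gcongr
      _ = ρ * n * δ := by ring
  have herr' : n * ∑ i, (g (x i) - ℓ (x i)) ^ 2 ≤ (η * n) ^ 2 := by
    calc n * ∑ i, (g (x i) - ℓ (x i)) ^ 2 ≤ n * (η ^ 2 * n) := by gcongr
      _ = (η * n) ^ 2 := by ring
  have key := card_confSet_le g ℓ ξhat hξhat x hξ (d := d) (h := h) (α := α)
    (v := η ^ 2 * α / 2 * (n * √n)) hδ hδ₀ hδ₁ hc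
    (by exact_mod_cast lt_of_lt_of_le (by linarith : (0 : ℝ) < u) hhge)
    (hnξ.trans (mul_le_mul_of_nonneg_right hleft hδ.le))
    (hnξ.trans (mul_le_mul_of_nonneg_right hright hδ.le)) ((div_le_iff₀ hδ).1 hdge) herr' hv ?_ ?_
    (abs_le_of_sq_le_sq hYξ hc.le) (abs_le_of_sq_le_sq hYn hc.le)
  · have hQ' : (∑ s ∈ Finset.range (n + 1),
        prefixSum (fun i => ℓ (x i) - stepMean n ξ m₀ m₁ i) s ^ 2) / (η * n) ^ 2 ≤ ε / 8 * n := by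
      rw [div_le_iff₀ (by positivity)]
      refine hQ.trans (le_of_eq ?_)
      ring
    rw [div_lt_iff₀ (by linarith)]
    nlinarith
  · calc (h : ℝ) * (η ^ 2 * α / 2 * (n * √n)) ≤ 2 * u * (η ^ 2 * α / 2 * (n * √n)) := by gcongr
      _ = η ^ 2 * n * (u * α) * √n := by ring
      _ = η ^ 2 * n * (√n * √n) := by rw [huα]; ring
      _ ≤ (η * n) ^ 2 := by rw [hsq]; exact le_of_eq (by ring)
  · calc ((n : ℝ) + 1) * (η ^ 2 * α / 2 * (n * √n)) ≤ (2 * n) * (η ^ 2 * α / 2 * (n * √n)) := by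
          gcongr; linarith
      _ = α * (√n * (η * n) ^ 2) := by ring
      _ = α * (u * α * (η * n) ^ 2) := by rw [huα]
      _ ≤ α * (u * 1 * (η * n) ^ 2) := by gcongr
      _ ≤ α * (h * (η * n) ^ 2) := mul_le_mul_of_nonneg_left
          (mul_le_mul_of_nonneg_right (by linarith) (sq_nonneg _)) hα.le

end Deterministic

end Conch

namespace Conch

/-! ### Sign of the drift. -/

section LogLikelihoodRatio

theorem logLR_swap {𝒳 : Type*} (f₀ f₁ : 𝒳 → ℝ≥0) (x : 𝒳) : logLR f₁ f₀ x = -logLR f₀ f₁ x := by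
  unfold logLR
  rw [← Real.log_inv, inv_div]

variable {𝒳 : Type*} [MeasurableSpace 𝒳]

theorem measurable_logLR {f₀ f₁ : 𝒳 → ℝ≥0} (hf₀ : Measurable f₀) (hf₁ : Measurable f₁) :
    Measurable (logLR f₀ f₁) :=
  Real.measurable_log.comp (hf₀.coe_nnreal_real.div hf₁.coe_nnreal_real)

/-- Gibbs' inequality, in strict form: the Kullback–Leibler divergence is positive when the
log-likelihood ratio is not almost surely constant. -/
theorem integral_logLR_pos (ν P₀ P₁ : Measure 𝒳) [IsProbabilityMeasure P₀]
    [IsProbabilityMeasure P₁] (f₀ f₁ : 𝒳 → ℝ≥0) (hf₀ : Measurable f₀) (hf₁ : Measurable f₁)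
    (hP₀ : P₀ = ν.withDensity fun x => (f₀ x : ℝ≥0∞))
    (hP₁ : P₁ = ν.withDensity fun x => (f₁ x : ℝ≥0∞))
    (hfin : ∀ᵐ x ∂P₀, 0 < f₁ x) (hint : Integrable (logLR f₀ f₁) P₀)
    (hvar : 0 < evariance (logLR f₀ f₁) P₀) : 0 < ∫ x, logLR f₀ f₁ x ∂P₀ := by
  have hpos : ∀ᵐ x ∂P₀, 0 < f₀ x := by
    rw [hP₀, ae_withDensity_iff hf₀.coe_nnreal_ennreal]
    exact ae_of_all _ fun x hx => pos_iff_ne_zero.2 (by simpa using hx)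
  have hrm : Measurable fun x => f₁ x / f₀ x := hf₁.div hf₀
  -- An inequality suffices: the region `f₀ = 0` contributes nothing on the left.
  have hrl : ∫⁻ x, ((f₁ x / f₀ x : ℝ≥0) : ℝ≥0∞) ∂P₀ ≤ 1 := by
    have h1 : ∫⁻ x, (f₁ x : ℝ≥0∞) ∂ν = 1 := by
      have := measure_univ (μ := P₁)
      rwa [hP₁, withDensity_apply _ MeasurableSet.univ, Measure.restrict_univ] at this
    rw [hP₀, lintegral_withDensity_eq_lintegral_mul ν hf₀.coe_nnreal_ennreal
      hrm.coe_nnreal_ennreal, ← h1]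
    refine lintegral_mono fun x => ?_
    simp only [Pi.mul_apply]
    rw [← ENNReal.coe_mul]
    refine ENNReal.coe_le_coe.2 ?_
    rcases eq_or_ne (f₀ x) 0 with h | h
    · simp [h]
    · rw [mul_div_cancel₀ _ h]
  set r : 𝒳 → ℝ := fun x => ((f₁ x / f₀ x : ℝ≥0) : ℝ) with hr
  have hri : Integrable r P₀ := by
    refine ⟨hrm.coe_nnreal_real.aestronglyMeasurable, ?_⟩
    rw [HasFiniteIntegral]
    refine lt_of_le_of_lt ?_ (hrl.trans_lt ENNReal.one_lt_top)
    refine lintegral_mono fun x => ?_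
    simp [hr, enorm_eq_nnnorm]
  have hr1 : ∫ x, r x ∂P₀ ≤ 1 := by
    rw [integral_eq_lintegral_of_nonneg_ae (ae_of_all _ fun x => NNReal.coe_nonneg _)
      hri.aestronglyMeasurable]
    refine ENNReal.toReal_le_of_le_ofReal zero_le_one ?_
    simp only [ENNReal.ofReal_coe_nnreal, ENNReal.ofReal_one]
    exact hrl
  have hlog : ∀ᵐ x ∂P₀, 0 < r x ∧ logLR f₀ f₁ x = -Real.log (r x) := by
    filter_upwards [hfin, hpos] with x h1 h0
    refine ⟨by simp only [hr]; exact_mod_cast div_pos h1 h0, ?_⟩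
    simp only [hr, logLR, NNReal.coe_div]
    rw [← Real.log_inv, inv_div]
  -- This is `log r ≤ r - 1`. If the mean were nonpositive, equality would hold almost everywhere,
  -- forcing `r = 1` and zero variance.
  have hnn : 0 ≤ᵐ[P₀] fun x => logLR f₀ f₁ x - (1 - r x) := by
    filter_upwards [hlog] with x hx
    simp only [Pi.zero_apply]
    rw [hx.2]
    linarith [Real.log_le_sub_one_of_pos hx.1]
  have hii : Integrable (fun x => 1 - r x) P₀ := (integrable_const 1).sub hri
  have hval : ∫ x, (logLR f₀ f₁ x - (1 - r x)) ∂P₀ =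
      ∫ x, logLR f₀ f₁ x ∂P₀ - (1 - ∫ x, r x ∂P₀) := by
    rw [integral_sub hint hii, integral_sub (integrable_const 1) hri]
    simp
  by_contra! hle
  have hzero : ∫ x, (logLR f₀ f₁ x - (1 - r x)) ∂P₀ = 0 :=
    le_antisymm (by linarith) (integral_nonneg_of_ae hnn)
  have hae := (integral_eq_zero_iff_of_nonneg_ae hnn (hint.sub hii)).1 hzero
  have hae0 : logLR f₀ f₁ =ᵐ[P₀] 0 := by
    filter_upwards [hae, hlog] with x hx hlx
    simp only [Pi.zero_apply] at hx ⊢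
    have : r x = 1 := by
      by_contra hne
      have := Real.log_lt_sub_one_of_pos hlx.1 hne
      linarith [hlx.2]
    rw [hlx.2, this, Real.log_one, neg_zero]
  rw [evariance_congr hae0, evariance_zero] at hvar
  exact lt_irrefl _ hvar

end LogLikelihoodRatio

/-! ### Second moments of the sample. -/

section Moments

theorem measure_le_ofReal_integral_div {Ω : Type*} [MeasurableSpace Ω] {μ : Measure Ω}
    [IsFiniteMeasure μ] {f : Ω → ℝ} (hf : ∀ ω, 0 ≤ f ω) (hi : Integrable f μ) {B c : ℝ}
    (hB : ∫ ω, f ω ∂μ ≤ B) (hc : 0 < c) : μ {ω | c ≤ f ω} ≤ ENNReal.ofReal (B / c) := by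
  rw [← ofReal_measureReal]
  refine ENNReal.ofReal_le_ofReal ?_
  rw [le_div_iff₀ hc, mul_comm]
  exact (mul_meas_ge_le_integral_of_nonneg (ae_of_all _ hf) hi c).trans hB

variable {Ω 𝒳 : Type*} [MeasurableSpace Ω] [MeasurableSpace 𝒳] {μ : Measure Ω}

theorem integral_sq_sum_le [IsProbabilityMeasure μ] {ι : Type*} {U : ι → Ω → ℝ}
    (hU : ∀ i, MemLp (U i) 2 μ) (hmean : ∀ i, ∫ ω, U i ω ∂μ = 0)
    (hind : Pairwise fun i j => IndepFun (U i) (U j) μ) {V : ℝ}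
    (hV : ∀ i, ∫ ω, U i ω ^ 2 ∂μ ≤ V) (A : Finset ι) :
    ∫ ω, (∑ i ∈ A, U i ω) ^ 2 ∂μ ≤ A.card * V := by
  have hA : MemLp (∑ i ∈ A, U i) 2 μ := memLp_finsetSum' A fun i _ => hU i
  have hA0 : ∫ ω, (∑ i ∈ A, U i) ω ∂μ = 0 := by
    simp only [Finset.sum_apply]
    rw [integral_finsetSum _ fun i _ => (hU i).integrable one_le_two]
    exact Finset.sum_eq_zero fun i _ => hmean i
  have h := IndepFun.variance_sum (fun i _ => hU i) (hind.set_pairwise (A : Set ι))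
  rw [variance_of_integral_eq_zero hA.aemeasurable hA0] at h
  simp only [Finset.sum_apply] at h
  rw [h, ← nsmul_eq_mul, ← Finset.sum_const]
  refine Finset.sum_le_sum fun i _ => ?_
  rw [variance_of_integral_eq_zero (hU i).aemeasurable (hmean i)]
  exact hV i

variable {n ξ : ℕ} {X : Fin n → Ω → 𝒳} {P₀ P₁ : Measure 𝒳}

theorem IsIIDChangepoint.law (h : IsIIDChangepoint X μ P₀ P₁ ξ) (i : Fin n) :
    HasLaw (X i) (if (i : ℕ) < ξ then P₀ else P₁) μ := by
  split_ifs with hi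
  · exact h.law_pre i hi
  · exact h.law_post i (by omega)

theorem IsIIDChangepoint.aemeasurable (h : IsIIDChangepoint X μ P₀ P₁ ξ) (i : Fin n) :
    AEMeasurable (X i) μ := (h.law i).aemeasurable

theorem IsIIDChangepoint.memLp_comp (h : IsIIDChangepoint X μ P₀ P₁ ξ) {ℓ : 𝒳 → ℝ}
    (h₀ : MemLp ℓ 2 P₀) (h₁ : MemLp ℓ 2 P₁) (i : Fin n) : MemLp (fun ω => ℓ (X i ω)) 2 μ := by
  have hl : MemLp ℓ 2 (μ.map (X i)) := by
    rw [(h.law i).map_eq]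
    split_ifs
    exacts [h₀, h₁]
  exact hl.comp_of_map (h.aemeasurable i)

theorem IsIIDChangepoint.integral_sq_comp_le (h : IsIIDChangepoint X μ P₀ P₁ ξ) {ℓ : 𝒳 → ℝ}
    (hℓ : Measurable ℓ) (i : Fin n) :
    ∫ ω, ℓ (X i ω) ^ 2 ∂μ ≤ ∫ x, ℓ x ^ 2 ∂P₀ + ∫ x, ℓ x ^ 2 ∂P₁ := by
  have h0 : 0 ≤ ∫ x, ℓ x ^ 2 ∂P₀ := integral_nonneg fun _ => sq_nonneg _
  have h1 : 0 ≤ ∫ x, ℓ x ^ 2 ∂P₁ := integral_nonneg fun _ => sq_nonneg _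
  have := (h.law i).integral_comp (f := fun x => ℓ x ^ 2) (hℓ.pow_const 2).aestronglyMeasurable
  simp only [Function.comp_def] at this
  rw [this]
  split_ifs <;> linarith

theorem IsIIDChangepoint.integral_comp (h : IsIIDChangepoint X μ P₀ P₁ ξ) {ℓ : 𝒳 → ℝ}
    (hℓ : Measurable ℓ) (i : Fin n) :
    ∫ ω, ℓ (X i ω) ∂μ = stepMean n ξ (∫ x, ℓ x ∂P₀) (∫ x, ℓ x ∂P₁) i := by
  have := (h.law i).integral_comp (f := ℓ) hℓ.aestronglyMeasurable
  simp only [Function.comp_def] at this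
  rw [this, stepMean]
  split_ifs <;> rfl

theorem IsIIDChangepoint.memLp_prefixSum [IsProbabilityMeasure μ]
    (h : IsIIDChangepoint X μ P₀ P₁ ξ) {ℓ : 𝒳 → ℝ} (h₀ : MemLp ℓ 2 P₀) (h₁ : MemLp ℓ 2 P₁)
    (m : Fin n → ℝ) (s : ℕ) : MemLp (fun ω => prefixSum (fun i => ℓ (X i ω) - m i) s) 2 μ :=
  memLp_finsetSum _ fun i _ => (h.memLp_comp h₀ h₁ i).sub (memLp_const _)

theorem IsIIDChangepoint.integral_sq_prefixSum_le [IsProbabilityMeasure μ]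
    (h : IsIIDChangepoint X μ P₀ P₁ ξ) {ℓ : 𝒳 → ℝ} (hℓ : Measurable ℓ) (h₀ : MemLp ℓ 2 P₀)
    (h₁ : MemLp ℓ 2 P₁) (s : ℕ) :
    ∫ ω, prefixSum (fun i => ℓ (X i ω) - stepMean n ξ (∫ x, ℓ x ∂P₀) (∫ x, ℓ x ∂P₁) i) s ^ 2 ∂μ
      ≤ n * (∫ x, ℓ x ^ 2 ∂P₀ + ∫ x, ℓ x ^ 2 ∂P₁) := by
  set m := stepMean n ξ (∫ x, ℓ x ∂P₀) (∫ x, ℓ x ∂P₁) with hm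
  have hL := h.memLp_comp h₀ h₁
  have hmean : ∀ i, ∫ ω, (ℓ (X i ω) - m i) ∂μ = 0 := by
    intro i
    rw [integral_sub ((hL i).integrable one_le_two) (integrable_const _), h.integral_comp hℓ i]
    simp [hm]
  have hU : ∀ i, MemLp (fun ω => ℓ (X i ω) - m i) 2 μ := fun i => (hL i).sub (memLp_const _)
  have hV : ∀ i, ∫ ω, (ℓ (X i ω) - m i) ^ 2 ∂μ ≤ ∫ x, ℓ x ^ 2 ∂P₀ + ∫ x, ℓ x ^ 2 ∂P₁ := by
    intro i
    rw [← variance_of_integral_eq_zero (hU i).aemeasurable (hmean i),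
      variance_sub_const (hL i).aestronglyMeasurable]
    exact (variance_le_expectation_sq (hL i).aestronglyMeasurable).trans
      (h.integral_sq_comp_le hℓ i)
  have hind : Pairwise fun i j =>
      IndepFun (fun ω => ℓ (X i ω) - m i) (fun ω => ℓ (X j ω) - m j) μ := fun i j hij =>
    (h.indep.indepFun hij).comp (φ := fun x => ℓ x - m i) (ψ := fun x => ℓ x - m j)
      (hℓ.sub_const _) (hℓ.sub_const _)
  refine (integral_sq_sum_le hU hmean hind hV _).trans ?_
  have hW : 0 ≤ ∫ x, ℓ x ^ 2 ∂P₀ + ∫ x, ℓ x ^ 2 ∂P₁ :=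
    add_nonneg (integral_nonneg fun _ => sq_nonneg _) (integral_nonneg fun _ => sq_nonneg _)
  refine mul_le_mul_of_nonneg_right ?_ hW
  exact_mod_cast (Finset.card_le_univ _).trans (Fintype.card_fin n).le

/-- Summed over the sample, the squared error of an independently learned function is at most `n`
times its risk. -/
theorem IsIIDChangepoint.lintegral_sum_error_le [IsProbabilityMeasure μ] [SFinite P₀] [SFinite P₁]
    (h : IsIIDChangepoint X μ P₀ P₁ ξ) {𝒟 : Type*} [MeasurableSpace 𝒟] {D : Ω → 𝒟}
    (hD : Measurable D) (hindep : IndepFun D (fun ω i => X i ω) μ) {e : 𝒟 → 𝒳 → ℝ≥0∞}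
    (he : Measurable (Function.uncurry e)) :
    ∫⁻ ω, ∑ i, e (D ω) (X i ω) ∂μ
      ≤ n * (∫⁻ ω, ∫⁻ x, e (D ω) x ∂P₀ ∂μ + ∫⁻ ω, ∫⁻ x, e (D ω) x ∂P₁ ∂μ) := by
  have hpair : ∀ i, AEMeasurable (fun ω => (D ω, X i ω)) μ := fun i =>
    hD.aemeasurable.prodMk (h.aemeasurable i)
  rw [lintegral_finsetSum' (f := fun i ω => e (D ω) (X i ω)) _
    fun i _ => he.comp_aemeasurable (hpair i)]
  refine (Finset.sum_le_sum (g := fun _ =>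
    ∫⁻ ω, ∫⁻ x, e (D ω) x ∂P₀ ∂μ + ∫⁻ ω, ∫⁻ x, e (D ω) x ∂P₁ ∂μ) fun i _ => ?_).trans
    (by simp [mul_add])
  have hi : IndepFun D (X i) μ := hindep.comp measurable_id (measurable_pi_apply i)
  have hmap := (indepFun_iff_map_prod_eq_prod_map_map hD.aemeasurable (h.aemeasurable i)).1 hi
  -- By independence the joint law of dataset and observation is a product, so Tonelli turns the
  -- expected error into the risk.
  have key : ∀ (P : Measure 𝒳) [SFinite P], μ.map (X i) = P →
      ∫⁻ ω, e (D ω) (X i ω) ∂μ = ∫⁻ ω, ∫⁻ x, e (D ω) x ∂P ∂μ := by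
    intro P _ hP
    calc ∫⁻ ω, e (D ω) (X i ω) ∂μ
        = ∫⁻ z, Function.uncurry e z ∂(μ.map fun ω => (D ω, X i ω)) :=
          (lintegral_map' he.aemeasurable (hpair i)).symm
      _ = ∫⁻ d, ∫⁻ x, e d x ∂P ∂(μ.map D) := by
          rw [hmap, hP, lintegral_prod _ he.aemeasurable]
          rfl
      _ = _ := lintegral_map he.lintegral_prod_right hD
  by_cases hlt : (i : ℕ) < ξ
  · rw [key P₀ (h.law_pre i hlt).map_eq]
    exact le_self_add
  · rw [key P₁ (h.law_post i (by omega)).map_eq]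
    exact le_add_self

end Moments

end Conch

/-! ### Union bound and passage to the limit. -/

namespace Conch

variable {Ω 𝒳 𝒟 : Type*} [MeasurableSpace Ω] [MeasurableSpace 𝒳] [MeasurableSpace 𝒟]
  {μ : Measure Ω} [IsProbabilityMeasure μ] {n ξ : ℕ} {X : Fin n → Ω → 𝒳} {P₀ P₁ : Measure 𝒳}
  {D : Ω → 𝒟}

theorem IsIIDChangepoint.measure_sum_sq_error_le [SFinite P₀] [SFinite P₁]
    (h : IsIIDChangepoint X μ P₀ P₁ ξ) (hD : Measurable D)
    (hindep : IndepFun D (fun ω i => X i ω) μ) {r : 𝒟 → 𝒳 → ℝ}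
    (hr : Measurable fun p : 𝒟 × 𝒳 => r p.1 p.2) {η : ℝ} (hη : 0 < η)
    (hn : 0 < n) :
    μ {ω | ENNReal.ofReal (η ^ 2 * n) ≤ ∑ i, ‖r (D ω) (X i ω)‖ₑ ^ 2} ≤
      (∫⁻ ω, ∫⁻ x, ‖r (D ω) x‖ₑ ^ 2 ∂P₀ ∂μ + ∫⁻ ω, ∫⁻ x, ‖r (D ω) x‖ₑ ^ 2 ∂P₁ ∂μ) /
        ENNReal.ofReal (η ^ 2) := by
  have hem : Measurable (Function.uncurry fun d x => ‖r d x‖ₑ ^ 2) := hr.enorm.pow_const 2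
  have hn0 : (0 : ℝ) < n := by exact_mod_cast hn
  have hRm : AEMeasurable (fun ω => ∑ i, ‖r (D ω) (X i ω)‖ₑ ^ 2) μ :=
    Finset.aemeasurable_fun_sum _ fun i _ =>
      hem.comp_aemeasurable (hD.aemeasurable.prodMk (h.aemeasurable i))
  have hne : ENNReal.ofReal (η ^ 2 * n) ≠ 0 := (ENNReal.ofReal_pos.2 (by positivity)).ne'
  refine (meas_ge_le_lintegral_div hRm hne ENNReal.ofReal_ne_top).trans ?_
  rw [mul_comm (η ^ 2), ENNReal.ofReal_mul hn0.le, ENNReal.ofReal_natCast]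
  refine (ENNReal.div_le_div_right (h.lintegral_sum_error_le hD hindep hem) _).trans (le_of_eq ?_)
  exact ENNReal.mul_div_mul_left _ _ (by exact_mod_cast hn.ne') (ENNReal.natCast_ne_top n)

/-- Nonasymptotic bound on the probability that the confidence set is a non-negligible fraction of
the candidates. -/
theorem IsIIDChangepoint.measure_card_confSet_le [SFinite P₀] [SFinite P₁]
    (hM : IsIIDChangepoint X μ P₀ P₁ ξ) {ℓ : 𝒳 → ℝ} (hℓ : Measurable ℓ)
    (hL₀ : MemLp ℓ 2 P₀) (hL₁ : MemLp ℓ 2 P₁) (hD : Measurable D)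
    (hindep : IndepFun D (fun ω i => X i ω) μ) {g : 𝒟 → 𝒳 → ℝ}
    (hg : Measurable (Function.uncurry g)) {ξhat : 𝒟 → (Fin n → 𝒳) → ℕ}
    (hξhat : ∀ d x, IsMLE (g d) x (ξhat d x)) {m₀ m₁ δ ρ η α ε κ β W : ℝ}
    (hm₀ : m₀ = ∫ x, ℓ x ∂P₀) (hm₁ : m₁ = ∫ x, ℓ x ∂P₁)
    (hδ : 0 < δ) (hδ₀ : δ ≤ m₀) (hδ₁ : m₁ ≤ -δ)
    (hα0 : 0 < α) (hα1 : α ≤ 1) (hε : 0 < ε) (hη : 0 < η) (hηρ : 6 * η ≤ ρ * δ)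
    (hηε : 96 * η ≤ ε * δ) (hleft : ρ * n ≤ ξ) (hright : ρ * n ≤ n - ξ)
    (hn : 4 * (ε + 2) ≤ ε * n) (hκ : κ = η ^ 2 * ε / 8) (hβ : β = η ^ 2 * α / 2)
    (hW : W = ∫ x, ℓ x ^ 2 ∂P₀ + ∫ x, ℓ x ^ 2 ∂P₁) :
    μ {ω | ε ≤ ((confSet (llrScore (g (D ω)) (ξhat (D ω))) α (fun i => X i ω)).card : ℝ) /
        ((n : ℝ) - 1)} ≤
      ENNReal.ofReal (2 * W / κ / n) + (ENNReal.ofReal (W / η ^ 2 / n) +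
        ENNReal.ofReal (W / η ^ 2 / n)) + ENNReal.ofReal (W / β / √n) +
        (∫⁻ ω, ∫⁻ x, ‖g (D ω) x - ℓ x‖ₑ ^ 2 ∂P₀ ∂μ +
          ∫⁻ ω, ∫⁻ x, ‖g (D ω) x - ℓ x‖ₑ ^ 2 ∂P₁ ∂μ) / ENNReal.ofReal (η ^ 2) := by
  have hn2 : 2 ≤ n := by
    have := Finset.mem_Icc.1 hM.mem
    omega
  have hκ0 : 0 < κ := by rw [hκ]; positivity
  have hβ0 : 0 < β := by rw [hβ]; positivity
  have hW0 : 0 ≤ W := by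
    rw [hW]
    exact add_nonneg (integral_nonneg fun _ => sq_nonneg _) (integral_nonneg fun _ => sq_nonneg _)
  have hnR : (2 : ℝ) ≤ n := by exact_mod_cast hn2
  have hn0 : (0 : ℝ) < n := by linarith
  set Y : ℕ → Ω → ℝ := fun s ω =>
    prefixSum (fun i => ℓ (X i ω) - stepMean n (ξ) m₀ m₁ i) s with hY
  have hYint : ∀ s, Integrable (fun ω => Y s ω ^ 2) (μ) := fun s =>
    (hM.memLp_prefixSum hL₀ hL₁ _ s).integrable_sq
  have hYle : ∀ s, ∫ ω, Y s ω ^ 2 ∂(μ) ≤ n * W := fun s =>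
    by rw [hW]; simp only [hY, hm₀, hm₁]; exact hM.integral_sq_prefixSum_le hℓ hL₀ hL₁ s
  set Q : Ω → ℝ := fun ω => ∑ s ∈ Finset.range (n + 1), Y s ω ^ 2 with hQ
  set v : Ω → ℝ := fun ω => ∑ i, ℓ (X i ω) ^ 2 with hv
  set R : Ω → ℝ≥0∞ := fun ω => ∑ i, ‖g (D ω) (X i ω) - ℓ (X i ω)‖ₑ ^ 2 with hR
  -- Each centred partial sum has second moment at most `n * W`, so `Q` has mean of order `n ^ 2`,
  -- against a threshold of order `n ^ 3`.
  have hbQ : μ {ω | κ * (n : ℝ) ^ 3 ≤ Q ω} ≤ ENNReal.ofReal (2 * W / κ / n) := by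
    refine (measure_le_ofReal_integral_div (B := (n + 1) * (n * W))
      (fun ω => Finset.sum_nonneg fun _ _ => sq_nonneg _)
      (integrable_finsetSum _ fun s _ => hYint s) ?_ (by positivity)).trans
      (ENNReal.ofReal_le_ofReal ?_)
    · rw [integral_finsetSum _ fun s _ => hYint s]
      refine (Finset.sum_le_sum fun s _ => hYle s).trans ?_
      simp
    · rw [div_le_iff₀ (by positivity)]
      calc ((n : ℝ) + 1) * (n * W) ≤ (2 * n) * (n * W) := by gcongr; linarith
        _ = 2 * W / κ / n * (κ * (n : ℝ) ^ 3) := by field_simp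
  have hbY : ∀ s, μ {ω | (η * n) ^ 2 ≤ Y s ω ^ 2} ≤ ENNReal.ofReal (W / η ^ 2 / n) := by
    intro s
    refine (measure_le_ofReal_integral_div (fun ω => sq_nonneg _) (hYint s) (hYle s)
      (by positivity)).trans (le_of_eq (congrArg _ ?_))
    field_simp
  -- The mean is of order `n`; the slack `√n` in the threshold makes Markov's inequality sufficient.
  have hbv : μ {ω | β * (n * √n) ≤ v ω} ≤ ENNReal.ofReal (W / β / √n) := by
    have hint : ∀ i, Integrable (fun ω => ℓ (X i ω) ^ 2) (μ) := fun i =>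
      (hM.memLp_comp hL₀ hL₁ i).integrable_sq
    refine (measure_le_ofReal_integral_div (B := n * W)
      (fun ω => Finset.sum_nonneg fun _ _ => sq_nonneg _)
      (integrable_finsetSum _ fun i _ => hint i) ?_ (by positivity)).trans
      (le_of_eq (congrArg _ ?_))
    · rw [integral_finsetSum _ fun i _ => hint i]
      refine (Finset.sum_le_sum fun i _ => hM.integral_sq_comp_le hℓ i).trans ?_
      simp [hW, mul_add]
    · field_simp
  have hbR := hM.measure_sum_sq_error_le (r := fun d x => g d x - ℓ x) hD hindep
    (hg.sub (hℓ.comp measurable_snd)) hη (by omega)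
  -- Monotonicity of outer measure is enough, so `ξhat` needs no measurability.
  refine (measure_mono (t := {ω | κ * (n : ℝ) ^ 3 ≤ Q ω} ∪
    ({ω | (η * n) ^ 2 ≤ Y (ξ) ω ^ 2} ∪ {ω | (η * n) ^ 2 ≤ Y n ω ^ 2}) ∪
    {ω | β * (n * √n) ≤ v ω} ∪ {ω | ENNReal.ofReal (η ^ 2 * n) ≤ R ω}) ?_).trans ?_
  · intro ω hω
    by_contra hnot
    simp only [Set.mem_union, Set.mem_ofPred_eq, not_or, not_le] at hnot
    obtain ⟨⟨⟨h1, h2, h3⟩, h4⟩, h5⟩ := hnot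
    have hRω : R ω = ENNReal.ofReal
        (∑ i, (g (D ω) (X i ω) - ℓ (X i ω)) ^ 2) := by
      rw [ENNReal.ofReal_sum_of_nonneg fun _ _ => sq_nonneg _]
      refine Finset.sum_congr rfl fun i _ => ?_
      rw [← ofReal_norm, ← ENNReal.ofReal_pow (norm_nonneg _), Real.norm_eq_abs, sq_abs]
    rw [hRω, ENNReal.ofReal_lt_ofReal_iff_of_nonneg
      (Finset.sum_nonneg fun _ _ => sq_nonneg _)] at h5
    refine absurd (card_confSet_div_lt (g (D ω)) ℓ (ξhat (D ω))
      (hξhat (D ω)) (fun i => X i ω) hM.mem hδ hδ₀ hδ₁ hα0 hα1 hε hη hηρ hηε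
      hleft hright hn h5.le
      (hβ ▸ h4.le) h2.le h3.le (hκ ▸ h1.le))
      (not_lt.2 hω)
  · refine (measure_union_le _ _).trans (add_le_add ?_ hbR)
    refine (measure_union_le _ _).trans (add_le_add ?_ hbv)
    refine (measure_union_le _ _).trans (add_le_add hbQ ?_)
    exact (measure_union_le _ _).trans (add_le_add (hbY _) (hbY _))

end Conch

theorem mainTheorem5
    {𝒳 : Type*} [MeasurableSpace 𝒳]
    -- the pre- and post-change laws, with densities with respect to a common measure
    (ν P₀ P₁ : Measure 𝒳) [IsProbabilityMeasure P₀] [IsProbabilityMeasure P₁]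
    (f₀ f₁ : 𝒳 → ℝ≥0) (hf₀ : Measurable f₀) (hf₁ : Measurable f₁)
    (hP₀ : P₀ = ν.withDensity fun x => (f₀ x : ℝ≥0∞))
    (hP₁ : P₁ = ν.withDensity fun x => (f₁ x : ℝ≥0∞))
    -- the log-likelihood ratio is almost surely finite, with finite positive variances
    (hfin₀ : ∀ᵐ x ∂P₀, 0 < f₁ x) (hfin₁ : ∀ᵐ x ∂P₁, 0 < f₀ x)
    (hvar₀ : 0 < evariance (Conch.logLR f₀ f₁) P₀ ∧ evariance (Conch.logLR f₀ f₁) P₀ < ∞)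
    (hvar₁ : 0 < evariance (Conch.logLR f₀ f₁) P₁ ∧ evariance (Conch.logLR f₀ f₁) P₁ < ∞)
    -- for each sample size `n ≥ 2`, the data, with changepoint `ξ n`
    {Ω : ℕ → Type*} [∀ n, MeasurableSpace (Ω n)]
    (μ : ∀ n, Measure (Ω n)) [∀ n, IsProbabilityMeasure (μ n)]
    (X : ∀ n, Fin n → Ω n → 𝒳) (ξ : ℕ → ℕ)
    (hX : ∀ n, 2 ≤ n → Conch.IsIIDChangepoint (X n) (μ n) P₀ P₁ (ξ n))
    (τ : ℝ) (hτ : τ ∈ Set.Ioo (0 : ℝ) 1)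
    (hξ : Tendsto (fun n : ℕ => (ξ n : ℝ) / (n : ℝ)) atTop (𝓝 τ))
    -- the independent dataset `D n`, and the estimate of the log-likelihood ratio learned on it
    {𝒟 : ℕ → Type*} [∀ n, MeasurableSpace (𝒟 n)]
    (D : ∀ n, Ω n → 𝒟 n) (hD : ∀ n, Measurable (D n))
    (hindep : ∀ n, 2 ≤ n → IndepFun (D n) (fun ω i => X n i ω) (μ n))
    (lhat : ∀ n, 𝒟 n → 𝒳 → ℝ) (hlhat : ∀ n, Measurable (Function.uncurry (lhat n)))
    -- `L²`-consistency under `P₀` and under `P₁`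
    (hL2₀ : Tendsto
      (fun n => ∫⁻ ω, ∫⁻ x, ‖lhat n (D n ω) x - Conch.logLR f₀ f₁ x‖ₑ ^ 2 ∂P₀ ∂(μ n))
      atTop (𝓝 0))
    (hL2₁ : Tendsto
      (fun n => ∫⁻ ω, ∫⁻ x, ‖lhat n (D n ω) x - Conch.logLR f₀ f₁ x‖ₑ ^ 2 ∂P₁ ∂(μ n))
      atTop (𝓝 0))
    -- the changepoint estimate: any choice of a maximizer
    (ξhat : ∀ n, 𝒟 n → (Fin n → 𝒳) → ℕ)
    (hξhat : ∀ n, 2 ≤ n → ∀ d x, Conch.IsMLE (lhat n d) x (ξhat n d x))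
    (α : ℝ) (hα : α ∈ Set.Ioo (0 : ℝ) 1) :
    ∀ ε : ℝ, 0 < ε →
      Tendsto
        (fun n : ℕ => μ n {ω |
          ε ≤ ((Conch.confSet
                  (Conch.llrScore (lhat n (D n ω)) (ξhat n (D n ω))) α
                  (fun i => X n i ω)).card : ℝ) / ((n : ℝ) - 1)})
        atTop (𝓝 0) := by
  intro ε hε
  obtain ⟨hα0, hα1⟩ := hα
  set ℓ := Conch.logLR f₀ f₁ with hℓdef
  have hℓ : Measurable ℓ := Conch.measurable_logLR hf₀ hf₁
  have hL₀ : MemLp ℓ 2 P₀ := (evariance_lt_top_iff_memLp hℓ.aestronglyMeasurable).1 hvar₀.2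
  have hL₁ : MemLp ℓ 2 P₁ := (evariance_lt_top_iff_memLp hℓ.aestronglyMeasurable).1 hvar₁.2
  set m₀ := ∫ x, ℓ x ∂P₀ with hm₀
  set m₁ := ∫ x, ℓ x ∂P₁ with hm₁
  have hm₀pos : 0 < m₀ := Conch.integral_logLR_pos ν P₀ P₁ f₀ f₁ hf₀ hf₁ hP₀ hP₁ hfin₀
    (hL₀.integrable one_le_two) hvar₀.1
  -- Exchanging the two laws negates `ℓ` and preserves its variance, so the same Gibbs inequality
  -- applies.
  have hm₁neg : m₁ < 0 := by
    have hswap : Conch.logLR f₁ f₀ = -ℓ := funext fun x => Conch.logLR_swap f₀ f₁ x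
    have := Conch.integral_logLR_pos ν P₁ P₀ f₁ f₀ hf₁ hf₀ hP₁ hP₀ hfin₁
      (by rw [hswap]; exact (hL₁.integrable one_le_two).neg)
      (by
        rw [hswap, show -ℓ = fun x => (-1 : ℝ) * ℓ x from funext fun x => (neg_one_mul _).symm,
          evariance_mul]
        simpa using hvar₁.1)
    rw [hswap] at this
    simp only [Pi.neg_apply, integral_neg] at this
    linarith
  set δ := min m₀ (-m₁) with hδdef
  have hδ : 0 < δ := lt_min hm₀pos (by linarith)
  have hδ₀ : δ ≤ m₀ := min_le_left _ _
  have hδ₁ : m₁ ≤ -δ := by linarith [min_le_right m₀ (-m₁)]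
  obtain ⟨ρ, hρ0, hρτ, hρ1⟩ : ∃ ρ, 0 < ρ ∧ ρ < τ ∧ τ < 1 - ρ :=
    ⟨min τ (1 - τ) / 2, by
        have := lt_min hτ.1 (sub_pos.2 hτ.2)
        linarith, by
        have := min_le_left τ (1 - τ)
        linarith [hτ.1], by
        have := min_le_right τ (1 - τ)
        linarith [hτ.2]⟩
  -- The first term makes the drift on either side of `ξ` exceed six error units `η * n`; the second
  -- keeps the undecided neighbourhood of `ξ` small relative to `ε * n`.
  set η := min (ρ * δ / 6) (ε * δ / 96) with hηdef
  have hη : 0 < η := lt_min (by positivity) (by positivity)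
  have hηρ : 6 * η ≤ ρ * δ := by linarith [min_le_left (ρ * δ / 6) (ε * δ / 96)]
  have hηε : 96 * η ≤ ε * δ := by linarith [min_le_right (ρ * δ / 6) (ε * δ / 96)]
  set W := ∫ x, ℓ x ^ 2 ∂P₀ + ∫ x, ℓ x ^ 2 ∂P₁ with hW
  set E : ℕ → ℝ≥0∞ := fun n =>
    ∫⁻ ω, ∫⁻ x, ‖lhat n (D n ω) x - ℓ x‖ₑ ^ 2 ∂P₀ ∂(μ n) +
      ∫⁻ ω, ∫⁻ x, ‖lhat n (D n ω) x - ℓ x‖ₑ ^ 2 ∂P₁ ∂(μ n) with hE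
  set κ := η ^ 2 * ε / 8 with hκ
  set β := η ^ 2 * α / 2 with hβ
  set bound : ℕ → ℝ≥0∞ := fun n =>
    ENNReal.ofReal (2 * W / κ / n) + (ENNReal.ofReal (W / η ^ 2 / n) +
      ENNReal.ofReal (W / η ^ 2 / n)) + ENNReal.ofReal (W / β / √n) +
      E n / ENNReal.ofReal (η ^ 2) with hbound
  have hlim : Tendsto bound atTop (𝓝 0) := by
    have h1 : ∀ C : ℝ, Tendsto (fun n : ℕ => ENNReal.ofReal (C / n)) atTop (𝓝 0) := by
      intro C
      simpa using ENNReal.tendsto_ofReal (tendsto_const_div_atTop_nhds_zero_nat C)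
    have h2 : Tendsto (fun n : ℕ => ENNReal.ofReal (W / β / √n)) atTop (𝓝 0) := by
      have : Tendsto (fun n : ℕ => W / β / √n) atTop (𝓝 0) :=
        (Real.tendsto_sqrt_atTop.comp tendsto_natCast_atTop_atTop).const_div_atTop _
      simpa using ENNReal.tendsto_ofReal this
    have h3 : Tendsto (fun n => E n / ENNReal.ofReal (η ^ 2)) atTop (𝓝 0) := by
      have hE0 : Tendsto E atTop (𝓝 0) := by simpa using hL2₀.add hL2₁
      have := ENNReal.Tendsto.div_const (b := ENNReal.ofReal (η ^ 2)) hE0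
        (Or.inr (by simpa using hη.ne'))
      simpa using this
    simpa using (((h1 _).add ((h1 _).add (h1 _))).add h2).add h3
  refine tendsto_of_tendsto_of_tendsto_of_le_of_le' tendsto_const_nhds hlim
    (Eventually.of_forall fun _ => zero_le) ?_
  have hev1 : ∀ᶠ n : ℕ in atTop, 4 * (ε + 2) / ε ≤ (n : ℝ) :=
    tendsto_natCast_atTop_atTop.eventually_ge_atTop _
  filter_upwards [eventually_ge_atTop 2, hev1, hξ.eventually_const_lt hρτ,
    hξ.eventually_lt_const hρ1] with n hn2 hn hξl hξr
  have hn0 : (0 : ℝ) < n := by exact_mod_cast (by omega : 0 < n)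
  rw [div_le_iff₀ hε] at hn
  rw [lt_div_iff₀ hn0] at hξl
  rw [div_lt_iff₀ hn0] at hξr
  exact (hX n hn2).measure_card_confSet_le hℓ hL₀ hL₁ (hD n) (hindep n hn2) (hlhat n)
    (hξhat n hn2) hm₀ hm₁ hδ hδ₀ hδ₁ hα0 hα1.le hε hη hηρ hηε hξl.le (by linarith) (by linarith)
    hκ hβ hW
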